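/- Let $\phi$ be the standard normal density, let $L^2_\phi$ be the space of real functions $g$ on $\mathbb{R}$ with $\mathbb{E}\,g(Z)^2<\infty$ for $Z\sim\mathcal N(0,1)$, let $h_m(x)=\frac{(-1)^m}{\sqrt{m!}\,\phi(x)}\frac{d^m}{dx^m}\phi(x)$, $m\ge 0$, be the normalized (probabilists') Hermite polynomials, and for $g\in L^2_\phi$ let $\alpha_m[g]=\mathbb{E}[g(Z)h_m(Z)]$ be its Hermite coefficients. Let $\Sigma\in\mathbb{R}^{n\times n}$ be positive semidefinite with $\Sigma_{ii}=1$ for all $i$, and let $T=(T_1,\dots,T_n)\sim\mathcal N(0,\Sigma)$. Let $Y_0,w:\mathbb{R}\to\mathbb{R}$ be functions such that $Y_0w:t\mapsto Y_0(t)w(t)$ and $w$ belong to $L^2_\phi$. Put $W=(w(T_1),\dots,w(T_n))^\top$ and $Y_0\circ W=(Y_0(T_1)w(T_1),\dots,Y_0(T_n)w(T_n))^\top$. Then the coordinates of $Y_0\circ W$ and $W$ are square-integrable, all $\Sigma_{ij}$ lie in $[-1,1]$, the series $$f_{Y_0,w}(\rho)=\sum_{m=1}^\infty \alpha_m[Y_0w]^2\rho^m,\qquad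 f_w(\rho)=\sum_{m=1}^\infty \alpha_m[w]^2\rho^m$$ converge (absolutely) for every $\rho\in[-1,1]$, and the covariance matrices are obtained by applying these functions elementwise: $$\mathrm{Cov}(Y_0\circ W)=f_{Y_0,w}(\Sigma),\qquad \mathrm{Cov}(W)=f_w(\Sigma),$$ that is, $\mathrm{Cov}(Y_0\circ W)_{ij}=f_{Y_0,w}(\Sigma_{ij})$ and $\mathrm{Cov}(W)_{ij}=f_w(\Sigma_{ij})$ for all $i,j$. -/

import Mathlib

open MeasureTheory ProbabilityTheory
open scoped Matrix

noncomputable section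

namespace GaussianDesign

/-- The correlation elliptope: positive semidefinite real `n × n` matrices with unit diagonal. -/
def elliptope (n : ℕ) : Set (Matrix (Fin n) (Fin n) ℝ) :=
  {S | S.PosSemidef ∧ ∀ i, S i i = 1}

/-- A random vector `T = (T₁, …, Tₙ)` on the probability space `(Ω, P)` is a Gaussian design with
matrix `S` if `S` is a correlation matrix and `T ∼ N(0, S)`. -/
structure IsGaussianDesign {Ω : Type*} [MeasurableSpace Ω] {n : ℕ}
    (T : Ω → EuclideanSpace ℝ (Fin n)) (S : Matrix (Fin n) (Fin n) ℝ) (P : Measure Ω) : Prop where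
  mem_elliptope : S ∈ elliptope n
  hasLaw : HasLaw T (multivariateGaussian 0 S) P

/-- The random vector `(g(T₁), …, g(Tₙ))`, for a function `g : ℝ → ℝ`. -/
def applyVec {Ω : Type*} {n : ℕ} (g : ℝ → ℝ) (T : Ω → EuclideanSpace ℝ (Fin n)) :
    Ω → Fin n → ℝ :=
  fun ω i => g (T ω i)

/-- The covariance matrix `E[(V - E V) (V - E V)ᵀ]` of a random vector `V`. -/
def covMat {Ω : Type*} [MeasurableSpace Ω] {n : ℕ} (V : Ω → Fin n → ℝ) (P : Measure Ω) :
    Matrix (Fin n) (Fin n) ℝ :=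
  Matrix.of fun i j => cov[fun ω => V ω i, fun ω => V ω j; P]

/-- The normalized Hermite polynomial `h_m = He_m / √(m!)`, where `He_m` is the probabilists'
Hermite polynomial. -/
def normHermite (m : ℕ) (x : ℝ) : ℝ :=
  (Real.sqrt (m.factorial : ℝ))⁻¹ * Polynomial.aeval x (Polynomial.hermite m)

/-- The Hermite polynomial is `He_m = (-1)^m φ⁽ᵐ⁾ / φ`, with `φ` the standard normal density. -/
theorem normHermite_eq_deriv (m : ℕ) (x : ℝ) :
    normHermite m x = (Real.sqrt (m.factorial : ℝ))⁻¹ *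
      ((-1) ^ m / gaussianPDFReal 0 1 x * iteratedDeriv m (gaussianPDFReal 0 1) x) := by
  have hφ : gaussianPDFReal 0 1 =
      fun y : ℝ => (Real.sqrt (2 * Real.pi))⁻¹ * Real.exp (-(y ^ 2 / 2)) := by
    funext y
    simp [gaussianPDFReal, neg_div]
  have hc : (Real.sqrt (2 * Real.pi))⁻¹ ≠ 0 := by positivity
  have he : Real.exp (-(x ^ 2 / 2)) ≠ 0 := (Real.exp_pos _).ne'
  rw [normHermite, Polynomial.hermite_eq_deriv_gaussian, hφ, iteratedDeriv_const_mul_field,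
    iteratedDeriv_eq_iterate]
  field_simp

/-- The `m`-th Hermite coefficient `α_m[g] = E[g(Z) h_m(Z)]`, `Z ∼ N(0, 1)`. -/
def hermiteCoeff (m : ℕ) (g : ℝ → ℝ) : ℝ :=
  ∫ z, g z * normHermite m z ∂(gaussianReal 0 1)

/-- The `m`-th term `α_m[g]² ρ^m` of the covariance series of `g`. -/
def covTerm (g : ℝ → ℝ) (ρ : ℝ) (m : ℕ) : ℝ :=
  hermiteCoeff m g ^ 2 * ρ ^ m

/-- The covariance function `f_g(ρ) = ∑_{m ≥ 1} α_m[g]² ρ^m`. -/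
def covFun (g : ℝ → ℝ) (ρ : ℝ) : ℝ :=
  ∑' m : ℕ, covTerm g ρ (m + 1)

end GaussianDesign

end

namespace GaussianDesign

/-! This is Mehler's formula. For standard jointly Gaussian `U`, `V` with covariance `ρ`, write `V =
ρ U + R`; then `R` is uncorrelated with `U`, hence independent of it. Gaussian integration by parts
and induction on the degree give `E[h_m(U) h_k(V)] = δ_{mk} ρ^m`
(`integral_normHermite_mul_normHermite`). No joint density is used, so `ρ = ±1` needs no separate
case. The `h_m` form a Hilbert basis of `L²` of the Gaussian measure (`hermiteBasis`). Expanding `g`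
in it and using continuity of the inner product, `E[g(U) g(V)] = ∑ α_m[g]² ρ^m` (`hasSum_covTerm`).
The term `m = 0` is the product of the means, so the covariance is the sum over `m ≥ 1`. Coordinates
of `T` provide the pairs `(U, V)`, and `g` is `w` or `Y₀ w`. -/

open Polynomial NNReal ENNReal

/-! ### Polynomial moments and Gaussian integration by parts. -/

/-- Polynomials in a random variable with finite moments have finite moments. -/
theorem memLp_eval {Ω : Type*} [MeasurableSpace Ω] {μ : Measure Ω} [IsFiniteMeasure μ]
    {X : Ω → ℝ} (hX : ∀ q : ℝ≥0, MemLp X q μ) (p : ℝ[X]) (q : ℝ≥0) :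
    MemLp (fun ω => p.eval (X ω)) q μ := by
  induction p using Polynomial.induction_on' with
  | add p₁ p₂ h₁ h₂ => simpa only [eval_add] using! h₁.add h₂
  | monomial n a =>
    have hpow : ∀ (n : ℕ) (q : ℝ≥0), MemLp (fun ω => X ω ^ n) q μ := by
      intro n
      induction n with
      | zero => intro q; simpa using memLp_const (1 : ℝ)
      | succ n ih =>
        intro q
        have : ENNReal.HolderTriple ((2 * q : ℝ≥0) : ℝ≥0∞) ((2 * q : ℝ≥0) : ℝ≥0∞) (q : ℝ≥0∞) := by
          constructor
          rw [ENNReal.coe_mul, ENNReal.coe_ofNat,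
            ENNReal.mul_inv (Or.inl (by simp)) (Or.inl (by simp)), ← add_mul,
            ENNReal.inv_two_add_inv_two, one_mul]
        simpa only [pow_succ] using! (hX (2 * q)).mul' (ih (2 * q))
    simpa using (hpow n q).const_mul a

theorem memLp_two_eval {Ω : Type*} [MeasurableSpace Ω] {μ : Measure Ω} [IsFiniteMeasure μ]
    {X : Ω → ℝ} (hX : ∀ q : ℝ≥0, MemLp X q μ) (p : ℝ[X]) :
    MemLp (fun ω => p.eval (X ω)) 2 μ := by
  simpa using memLp_eval hX p 2

theorem integrable_eval_mul_eval {Ω : Type*} [MeasurableSpace Ω] {μ : Measure Ω}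
    [IsFiniteMeasure μ] {X Y : Ω → ℝ} (hX : ∀ q : ℝ≥0, MemLp X q μ)
    (hY : ∀ q : ℝ≥0, MemLp Y q μ) (p q : ℝ[X]) :
    Integrable (fun ω => p.eval (X ω) * q.eval (Y ω)) μ :=
  (memLp_two_eval hX p).integrable_mul (memLp_two_eval hY q)

theorem integrable_eval_gaussianReal (p : ℝ[X]) :
    Integrable (fun x => p.eval x) (gaussianReal 0 1) :=
  (memLp_two_eval (X := id) (fun q => memLp_id_gaussianReal q) p).integrable one_le_two

theorem integrable_eval_mul_gaussianPDFReal (p : ℝ[X]) :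
    Integrable (fun x => p.eval x * gaussianPDFReal 0 1 x) := by
  have h := integrable_eval_gaussianReal p
  rw [gaussianReal_of_var_ne_zero 0 one_ne_zero, integrable_withDensity_iff_integrable_smul'
    (measurable_gaussianPDF 0 1) (by simp [gaussianPDF])] at h
  simpa [gaussianPDF, toReal_ofReal (gaussianPDFReal_nonneg 0 1 _), mul_comm] using h

theorem hasDerivAt_gaussianPDFReal (x : ℝ) :
    HasDerivAt (gaussianPDFReal 0 1) (-(x * gaussianPDFReal 0 1 x)) x := by
  have h : HasDerivAt (fun y : ℝ => -(y - 0) ^ 2 / (2 * ((1 : ℝ≥0) : ℝ))) (-x) x := by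
    have := (((hasDerivAt_id x).pow 2).neg).div_const 2
    convert! this using 1
    · funext y; simp
    · simp; ring
  have h2 := (h.exp).const_mul (Real.sqrt (2 * Real.pi * ((1 : ℝ≥0) : ℝ)))⁻¹
  convert! h2 using 1
  simp only [gaussianPDFReal]
  ring

/-- Gaussian integration by parts for polynomials. -/
theorem integral_mul_eval_gaussianReal (p : ℝ[X]) :
    ∫ x, x * p.eval x ∂(gaussianReal 0 1) = ∫ x, p.derivative.eval x ∂(gaussianReal 0 1) := by
  simp_rw [integral_gaussianReal_eq_integral_smul (one_ne_zero : (1 : ℝ≥0) ≠ 0), smul_eq_mul]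
  have hXp := integrable_eval_mul_gaussianPDFReal (X * p)
  have h := integral_mul_deriv_eq_deriv_mul_of_integrable (u := fun x => p.eval x)
    (u' := fun x => p.derivative.eval x) (v := gaussianPDFReal 0 1)
    (v' := fun x => -(x * gaussianPDFReal 0 1 x)) (fun x _ => p.hasDerivAt x)
    (fun x _ => hasDerivAt_gaussianPDFReal x)
    (hXp.neg.congr (.of_forall fun x => by simp; ring))
    (integrable_eval_mul_gaussianPDFReal _) (integrable_eval_mul_gaussianPDFReal _)
  rw [← neg_inj]
  calc _ = ∫ x, p.eval x * -(x * gaussianPDFReal 0 1 x) := by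
        rw [← integral_neg]; congr 1; funext x; ring
    _ = _ := by rw [h]; congr 2; funext x; ring

theorem memLp_of_hasLaw_gaussianReal {Ω : Type*} [MeasurableSpace Ω] {μ : Measure Ω} {U : Ω → ℝ}
    (hU : HasLaw U (gaussianReal 0 1) μ) (q : ℝ≥0) : MemLp U q μ := by
  have := memLp_id_gaussianReal (μ := 0) (v := 1) q
  rw [← hU.map_eq] at this
  exact (memLp_map_measure_iff aestronglyMeasurable_id hU.aemeasurable).1 this

/-- Gaussian integration by parts for a pair `(U, ρ U + R)` with `U`, `R` independent and `U`
standard normal. -/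
theorem integral_mul_eval_mul_eval {Ω : Type*} [MeasurableSpace Ω] {μ : Measure Ω}
    [IsProbabilityMeasure μ] {U R : Ω → ℝ} (hU : HasLaw U (gaussianReal 0 1) μ)
    (hR : ∀ q : ℝ≥0, MemLp R q μ) (hUR : IndepFun U R μ) (ρ : ℝ) (p q : ℝ[X]) :
    ∫ ω, U ω * (p.eval (U ω) * q.eval (ρ * U ω + R ω)) ∂μ =
      ∫ ω, p.derivative.eval (U ω) * q.eval (ρ * U ω + R ω) ∂μ +
        ρ * ∫ ω, p.eval (U ω) * q.derivative.eval (ρ * U ω + R ω) ∂μ := by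
  have hUm := memLp_of_hasLaw_gaussianReal hU
  have hVm : ∀ q : ℝ≥0, MemLp (fun ω => ρ * U ω + R ω) q μ := fun q =>
    ((hUm q).const_mul ρ).add (hR q)
  have hRa : AEMeasurable R μ := (hR 1).1.aemeasurable
  have hprod : AEMeasurable (fun ω => (U ω, R ω)) μ := hU.aemeasurable.prodMk hRa
  have : IsProbabilityMeasure (μ.map R) := Measure.isProbabilityMeasure_map hRa
  have hmap : μ.map (fun ω => (U ω, R ω)) = (gaussianReal 0 1).prod (μ.map R) := by
    rw [(indepFun_iff_map_prod_eq_prod_map_map hU.aemeasurable hRa).1 hUR, hU.map_eq]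
  -- By independence and Fubini, `R` can be frozen at a value `r`, leaving a one-variable Gaussian
  -- integral.
  have key : ∀ a b : ℝ[X], Integrable (fun z : ℝ × ℝ => a.eval z.1 * b.eval (ρ * z.1 + z.2))
        ((gaussianReal 0 1).prod (μ.map R)) ∧
      ∫ ω, a.eval (U ω) * b.eval (ρ * U ω + R ω) ∂μ =
        ∫ r, ∫ x, a.eval x * b.eval (ρ * x + r) ∂(gaussianReal 0 1) ∂(μ.map R) := by
    intro a b
    have hm : Continuous (fun z : ℝ × ℝ => a.eval z.1 * b.eval (ρ * z.1 + z.2)) := by fun_prop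
    have hi : Integrable (fun z : ℝ × ℝ => a.eval z.1 * b.eval (ρ * z.1 + z.2))
        ((gaussianReal 0 1).prod (μ.map R)) := by
      rw [← hmap, integrable_map_measure hm.aestronglyMeasurable hprod]
      exact integrable_eval_mul_eval hUm hVm a b
    refine ⟨hi, ?_⟩
    rw [← integral_prod_symm _ hi, ← hmap, integral_map hprod hm.aestronglyMeasurable]
  have hlin : ∀ (b : ℝ[X]) (r x : ℝ), (b.comp (C ρ * X + C r)).eval x = b.eval (ρ * x + r) := by
    intro b r x; simp
  have hI : ∀ (a b : ℝ[X]) (r : ℝ),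
      Integrable (fun x => a.eval x * b.eval (ρ * x + r)) (gaussianReal 0 1) := by
    intro a b r
    exact (integrable_eval_gaussianReal (a * b.comp (C ρ * X + C r))).congr
      (.of_forall fun x => by simp)
  have h1 := (key (X * p) q).2
  simp only [eval_mul, eval_X, mul_assoc] at h1
  rw [h1, (key _ _).2, (key _ _).2, ← integral_const_mul, ← integral_add
    (key p.derivative q).1.integral_prod_right
    ((key p q.derivative).1.integral_prod_right.const_mul ρ)]
  congr 1
  funext r
  -- For fixed `r`, the second factor is a polynomial in `x` whose derivative yields the factor `ρ`
  -- by the chain rule.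
  have h2 := integral_mul_eval_gaussianReal (p * q.comp (C ρ * X + C r))
  simp only [eval_mul, hlin] at h2
  rw [h2, ← integral_const_mul, ← integral_add (hI _ _ r) ((hI _ _ r).const_mul ρ)]
  congr 1
  funext x
  simp [derivative_comp]
  ring

/-! ### Hermite polynomials and their mixed Gaussian moments. -/

theorem derivative_hermite_succ (n : ℕ) :
    derivative (hermite (n + 1)) = (n + 1 : ℤ[X]) * hermite n := by
  induction n with
  | zero => simp
  | succ n ih =>
    have h : derivative (hermite (n + 1 + 1)) =
        hermite (n + 1) + X * derivative (hermite (n + 1)) -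
          derivative (derivative (hermite (n + 1))) := by
      conv_lhs => rw [hermite_succ (n + 1)]
      simp
    have h2 : derivative ((n + 1 : ℤ[X]) * hermite n) = (n + 1 : ℤ[X]) * derivative (hermite n) := by
      simp [derivative_mul]
    rw [h, ih, h2, hermite_succ n]
    push_cast
    ring

/-- The Hermite polynomials with real coefficients. -/
noncomputable def realHermite (m : ℕ) : ℝ[X] :=
  (hermite m).map (Int.castRingHom ℝ)

theorem realHermite_zero : realHermite 0 = 1 := by
  simp [realHermite]

theorem realHermite_succ (m : ℕ) :
    realHermite (m + 1) = X * realHermite m - derivative (realHermite m) := by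
  simp [realHermite, hermite_succ, derivative_map]

theorem derivative_realHermite_succ (m : ℕ) :
    derivative (realHermite (m + 1)) = C (m + 1 : ℝ) * realHermite m := by
  rw [realHermite, derivative_map, derivative_hermite_succ]
  simp [realHermite]

theorem normHermite_eq_eval (m : ℕ) (x : ℝ) :
    normHermite m x = (Real.sqrt (m.factorial : ℝ))⁻¹ * (realHermite m).eval x := by
  rw [normHermite, realHermite, eval_map, aeval_def]
  rfl

theorem integral_realHermite_succ (m : ℕ) :
    ∫ x, (realHermite (m + 1)).eval x ∂(gaussianReal 0 1) = 0 := by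
  have h := integrable_eval_gaussianReal (X * realHermite m)
  simp only [eval_mul, eval_X] at h
  simp only [realHermite_succ, eval_sub, eval_mul, eval_X]
  rw [integral_sub h (integrable_eval_gaussianReal _), integral_mul_eval_gaussianReal, sub_self]

/-- Hermite polynomials of jointly Gaussian standard normal variables with correlation `ρ`. -/
theorem integral_realHermite_mul_realHermite {Ω : Type*} [MeasurableSpace Ω] {μ : Measure Ω}
    [IsProbabilityMeasure μ] {U R : Ω → ℝ} {ρ : ℝ} (hU : HasLaw U (gaussianReal 0 1) μ)
    (hV : HasLaw (fun ω => ρ * U ω + R ω) (gaussianReal 0 1) μ)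
    (hUR : IndepFun U R μ) (m k : ℕ) :
    ∫ ω, (realHermite m).eval (U ω) * (realHermite k).eval (ρ * U ω + R ω) ∂μ =
      if m = k then (m.factorial : ℝ) * ρ ^ m else 0 := by
  have hUm := memLp_of_hasLaw_gaussianReal hU
  have hVm := memLp_of_hasLaw_gaussianReal hV
  have hR : ∀ q : ℝ≥0, MemLp R q μ := fun q =>
    ((hVm q).sub ((hUm q).const_mul ρ)).congr_norm
      (((hVm q).1.sub ((hUm q).const_mul ρ).1).congr (.of_forall fun ω => by simp))
      (.of_forall fun ω => by simp)
  induction m generalizing k with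
  | zero =>
    have h := hV.integral_comp (f := fun x => (realHermite k).eval x)
      (by fun_prop : Continuous _).aestronglyMeasurable
    simp only [Function.comp_def] at h
    simp only [realHermite_zero, eval_one, one_mul, h]
    cases k with
    | zero => simp [realHermite_zero]
    | succ k => simpa using integral_realHermite_succ k
  | succ m ih =>
    have hI := integrable_eval_mul_eval hUm hVm
    -- Since `H_{m+1} = X H_m - H_m'`, integration by parts cancels the `H_m'` term and moves one
    -- derivative onto `H_k`, at the cost of a factor `ρ`.
    have h1 : ∫ ω, (realHermite (m + 1)).eval (U ω) * (realHermite k).eval (ρ * U ω + R ω) ∂μ =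
        ρ * ∫ ω, (realHermite m).eval (U ω) *
          (derivative (realHermite k)).eval (ρ * U ω + R ω) ∂μ := by
      have h2 := hI (X * realHermite m) (realHermite k)
      simp only [eval_mul, eval_X, mul_assoc] at h2
      simp only [realHermite_succ, eval_sub, eval_mul, eval_X, sub_mul, mul_assoc]
      rw [integral_sub h2 (hI _ _), integral_mul_eval_mul_eval hU hR hUR, add_sub_cancel_left]
    rw [h1]
    cases k with
    | zero => simp [realHermite_zero]
    | succ k =>
      simp only [derivative_realHermite_succ, eval_mul, eval_C, mul_left_comm]
      rw [integral_const_mul, ih]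
      simp only [Nat.add_right_cancel_iff]
      split_ifs with hmk
      · subst hmk
        rw [Nat.factorial_succ]
        push_cast
        ring
      · simp

theorem integral_normHermite_mul_normHermite {Ω : Type*} [MeasurableSpace Ω] {μ : Measure Ω}
    [IsProbabilityMeasure μ] {U R : Ω → ℝ} {ρ : ℝ} (hU : HasLaw U (gaussianReal 0 1) μ)
    (hV : HasLaw (fun ω => ρ * U ω + R ω) (gaussianReal 0 1) μ)
    (hUR : IndepFun U R μ) (m k : ℕ) :
    ∫ ω, normHermite m (U ω) * normHermite k (ρ * U ω + R ω) ∂μ =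
      if m = k then ρ ^ m else 0 := by
  have h1 : ∀ ω, normHermite m (U ω) * normHermite k (ρ * U ω + R ω) =
      ((Real.sqrt (m.factorial : ℝ))⁻¹ * (Real.sqrt (k.factorial : ℝ))⁻¹) *
        ((realHermite m).eval (U ω) * (realHermite k).eval (ρ * U ω + R ω)) := fun ω => by
    rw [normHermite_eq_eval, normHermite_eq_eval, mul_mul_mul_comm]
  simp only [h1]
  rw [integral_const_mul, integral_realHermite_mul_realHermite hU hV hUR]
  split_ifs with h
  · subst h
    have : (m.factorial : ℝ) ≠ 0 := by positivity
    rw [← mul_inv, Real.mul_self_sqrt (by positivity)]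
    field_simp
  · simp

theorem memLp_normHermite (m : ℕ) : MemLp (normHermite m) 2 (gaussianReal 0 1) := by
  have := (memLp_two_eval (X := id) (fun q => memLp_id_gaussianReal (μ := 0) (v := 1) q)
    (realHermite m)).const_mul (Real.sqrt (m.factorial : ℝ))⁻¹
  exact this.ae_eq (.of_forall fun x => (normHermite_eq_eval m x).symm)

/-- The degenerate pair `V = U`, with `ρ = 1` and `R = 0`. -/
theorem integral_normHermite_mul_self (m k : ℕ) :
    ∫ x, normHermite m x * normHermite k x ∂(gaussianReal 0 1) = if m = k then 1 else 0 := by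
  simpa using integral_normHermite_mul_normHermite (U := id) (R := fun _ => 0) (ρ := 1)
    (μ := gaussianReal 0 1) HasLaw.id (by simpa using! HasLaw.id) (indepFun_const_right _ _) m k

/-! ### Completeness of the Hermite system. -/

theorem memLp_exp_mul_abs (t : ℝ) :
    MemLp (fun x : ℝ => Real.exp (t * |x|)) 2 (gaussianReal 0 1) := by
  rw [memLp_two_iff_integrable_sq (by fun_prop)]
  refine (integrable_exp_mul_abs (X := id) (t := 2 * t) (integrable_exp_mul_gaussianReal _)
    (integrable_exp_mul_gaussianReal _)).congr (.of_forall fun x => ?_)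
  simp only [id, ← Real.exp_nat_mul]
  congr 1
  push_cast
  ring

/-- A function orthogonal to all monomials is orthogonal to all characters. -/
theorem integral_mul_cexp_eq_zero {g : ℝ → ℝ} (hg : MemLp g 2 (gaussianReal 0 1))
    (h : ∀ n : ℕ, ∫ x, g x * x ^ n ∂(gaussianReal 0 1) = 0) (t : ℝ) :
    ∫ x, (g x : ℂ) * Complex.exp (t * x * Complex.I) ∂(gaussianReal 0 1) = 0 := by
  have hexp : ∀ x : ℝ, HasSum (fun n : ℕ => |g x| * (|t| * |x|) ^ n / n.factorial)
      (|g x| * Real.exp (|t| * |x|)) := by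
    intro x
    simp only [mul_div_assoc]
    rw [Real.exp_eq_exp_ℝ]
    exact (NormedSpace.expSeries_div_hasSum_exp (|t| * |x|)).mul_left _
  -- The exponential series is integrated termwise; the dominating sum `|g x| exp(|t| |x|)` is
  -- integrable as a product of two `L²` functions.
  have hs := hasSum_integral_of_dominated_convergence (μ := gaussianReal 0 1)
    (F := fun (n : ℕ) (x : ℝ) => (g x : ℂ) * (t * x * Complex.I) ^ n / n.factorial)
    (f := fun x : ℝ => (g x : ℂ) * Complex.exp (t * x * Complex.I))
    (fun n x => |g x| * (|t| * |x|) ^ n / n.factorial) ?_ ?_ ?_ ?_ ?_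
  · refine hs.unique ?_
    have hF : ∀ (n : ℕ) (x : ℝ), (g x : ℂ) * (t * x * Complex.I) ^ n / n.factorial =
        (t * Complex.I) ^ n / n.factorial * ((g x * x ^ n : ℝ) : ℂ) := by
      intro n x; push_cast; ring
    simp only [hF, integral_const_mul, integral_complex_ofReal, h, Complex.ofReal_zero, mul_zero]
    exact hasSum_zero
  · intro n
    have : Continuous fun x : ℝ => ((t : ℂ) * x * Complex.I) ^ n / n.factorial := by
      fun_prop
    exact ((Complex.continuous_ofReal.comp_aestronglyMeasurable hg.1).mul
      this.aestronglyMeasurable).congr (.of_forall fun x => (mul_div_assoc _ _ _).symm)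
  · intro n
    refine .of_forall fun x => le_of_eq ?_
    simp
  · exact .of_forall fun x => (hexp x).summable
  · simp only [fun x => (hexp x).tsum_eq]
    exact hg.abs.integrable_mul (memLp_exp_mul_abs |t|)
  · refine .of_forall fun x => ?_
    simp only [mul_div_assoc]
    rw [Complex.exp_eq_exp_ℂ]
    exact (NormedSpace.expSeries_div_hasSum_exp ((t : ℂ) * x * Complex.I)).mul_left _

/-- The Fourier transform with respect to a finite measure is injective on integrable functions. -/
theorem ae_eq_zero_of_integral_mul_cexp {μ : Measure ℝ} [IsFiniteMeasure μ] {g : ℝ → ℝ}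
    (hg : Integrable g μ)
    (h : ∀ t : ℝ, ∫ x, (g x : ℂ) * Complex.exp (t * x * Complex.I) ∂μ = 0) : g =ᵐ[μ] 0 := by
  have := isFiniteMeasure_withDensity_ofReal hg.2
  have := isFiniteMeasure_withDensity_ofReal hg.neg.2
  have hpos : AEMeasurable (fun x => ENNReal.ofReal (g x)) μ := hg.1.aemeasurable.ennreal_ofReal
  have hneg : AEMeasurable (fun x => ENNReal.ofReal ((-g) x)) μ :=
    hg.neg.1.aemeasurable.ennreal_ofReal
  have hbdd : ∀ (t : ℝ) (f : ℝ → ℝ), Integrable f μ →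
      Integrable (fun x => ((max (f x) 0 : ℝ) : ℂ) * Complex.exp (t * x * Complex.I)) μ := by
    intro t f hf
    refine (hf.pos_part.ofReal (𝕜 := ℂ)).mul_bdd (c := 1)
      (by fun_prop : Continuous _).aestronglyMeasurable (.of_forall fun x => ?_)
    rw [← Complex.ofReal_mul, Complex.norm_exp_ofReal_mul_I]
  -- The positive and negative parts of `g` are densities of two finite measures with the same
  -- characteristic function.
  have heq : μ.withDensity (fun x => ENNReal.ofReal (g x)) =
      μ.withDensity (fun x => ENNReal.ofReal ((-g) x)) := by
    refine Measure.ext_of_charFun (funext fun t => ?_)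
    rw [charFun_apply_real, charFun_apply_real,
      integral_withDensity_eq_integral_toReal_smul₀ hpos (by simp),
      integral_withDensity_eq_integral_toReal_smul₀ hneg (by simp), ← sub_eq_zero]
    simp only [toReal_ofReal', Complex.real_smul]
    rw [← integral_sub (hbdd t g hg) (hbdd t _ hg.neg), ← h t]
    congr 1
    funext x
    rw [← sub_mul, ← Complex.ofReal_sub, Pi.neg_apply, max_zero_sub_max_neg_zero_eq_self]
  rw [withDensity_eq_iff_of_sigmaFinite hpos hneg] at heq
  filter_upwards [heq] with x hx
  simp only [Pi.neg_apply] at hx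
  rcases le_total (g x) 0 with h0 | h0
  · rw [ENNReal.ofReal_of_nonpos h0, eq_comm, ENNReal.ofReal_eq_zero] at hx
    exact le_antisymm h0 (by simpa using hx)
  · rw [ENNReal.ofReal_of_nonpos (by linarith : -g x ≤ 0), ENNReal.ofReal_eq_zero] at hx
    exact le_antisymm hx h0

/-- A square-integrable function with vanishing Hermite coefficients is orthogonal to all
monomials. -/
theorem integral_mul_pow_eq_zero {g : ℝ → ℝ} (hg : MemLp g 2 (gaussianReal 0 1))
    (h : ∀ m, ∫ x, g x * normHermite m x ∂(gaussianReal 0 1) = 0) (n : ℕ) :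
    ∫ x, g x * x ^ n ∂(gaussianReal 0 1) = 0 := by
  have hH : ∀ m, ∫ x, g x * (realHermite m).eval x ∂(gaussianReal 0 1) = 0 := by
    intro m
    have hm := h m
    simp only [normHermite_eq_eval, mul_left_comm (g _)] at hm
    rw [integral_const_mul] at hm
    exact (mul_eq_zero.1 hm).resolve_left (by positivity)
  have hint : ∀ p : ℝ[X], Integrable (fun x => g x * p.eval x) (gaussianReal 0 1) := fun p =>
    hg.integrable_mul (memLp_two_eval (X := id) (fun q => memLp_id_gaussianReal q) p)
  -- Stronger than needed so that the induction closes: `X H_m = H_{m+1} + H_m'` trades a power of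
  -- `X` for shifts of the Hermite index.
  have key : ∀ n m, ∫ x, g x * (X ^ n * realHermite m).eval x ∂(gaussianReal 0 1) = 0 := by
    intro n
    induction n with
    | zero => simpa using hH
    | succ n ih =>
      intro m
      have hX : X ^ (n + 1) * realHermite m =
          X ^ n * realHermite (m + 1) + X ^ n * derivative (realHermite m) := by
        rw [realHermite_succ]; ring
      simp only [hX, eval_add, mul_add]
      rw [integral_add (hint _) (hint _), ih, zero_add]
      cases m with
      | zero => simp [realHermite_zero]
      | succ m =>
        rw [derivative_realHermite_succ, mul_left_comm]
        simp only [eval_mul (p := C _), eval_C, mul_left_comm (g _)]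
        rw [integral_const_mul, ih, mul_zero]
  simpa [realHermite_zero] using key n 0

theorem ae_eq_zero_of_hermiteCoeff {g : ℝ → ℝ} (hg : MemLp g 2 (gaussianReal 0 1))
    (h : ∀ m, hermiteCoeff m g = 0) : g =ᵐ[gaussianReal 0 1] 0 :=
  ae_eq_zero_of_integral_mul_cexp (hg.integrable one_le_two)
    (integral_mul_cexp_eq_zero hg (integral_mul_pow_eq_zero hg h))

/-- The normalized Hermite polynomials as elements of `L²` of the standard Gaussian measure. -/
noncomputable def hermiteLp (m : ℕ) : Lp ℝ 2 (gaussianReal 0 1) :=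
  (memLp_normHermite m).toLp _

theorem inner_hermiteLp (m : ℕ) {g : ℝ → ℝ} (hg : MemLp g 2 (gaussianReal 0 1)) :
    inner ℝ (hermiteLp m) (hg.toLp g) = hermiteCoeff m g := by
  rw [L2.inner_def, hermiteCoeff]
  refine integral_congr_ae ?_
  filter_upwards [(memLp_normHermite m).coeFn_toLp, hg.coeFn_toLp] with x h1 h2
  rw [hermiteLp, h1, h2]
  rfl

theorem orthonormal_hermiteLp : Orthonormal ℝ hermiteLp := by
  classical
  rw [orthonormal_iff_ite]
  intro m k
  rw [show hermiteLp k = (memLp_normHermite k).toLp _ from rfl, inner_hermiteLp, hermiteCoeff,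
    integral_normHermite_mul_self]
  simp [eq_comm]

theorem orthogonal_span_hermiteLp : (Submodule.span ℝ (Set.range hermiteLp))ᗮ = ⊥ := by
  rw [Submodule.eq_bot_iff]
  intro f hf
  have hf' := Lp.memLp f
  rw [Submodule.mem_orthogonal] at hf
  have := ae_eq_zero_of_hermiteCoeff hf' fun m => by
    rw [← inner_hermiteLp m hf', Lp.toLp_coeFn]
    exact hf _ (Submodule.subset_span ⟨m, rfl⟩)
  exact (Lp.eq_zero_iff_ae_eq_zero).2 this

/-- The Hermite basis of `L²` of the standard Gaussian measure. -/
noncomputable def hermiteBasis : HilbertBasis ℕ ℝ (Lp ℝ 2 (gaussianReal 0 1)) :=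
  HilbertBasis.mkOfOrthogonalEqBot orthonormal_hermiteLp orthogonal_span_hermiteLp

theorem hermiteBasis_apply (m : ℕ) : hermiteBasis m = hermiteLp m :=
  congrFun (HilbertBasis.coe_mkOfOrthogonalEqBot _ _) m

theorem hasSum_hermiteCoeff_smul {g : ℝ → ℝ} (hg : MemLp g 2 (gaussianReal 0 1)) :
    HasSum (fun m => hermiteCoeff m g • hermiteLp m) (hg.toLp g) := by
  simpa [HilbertBasis.repr_apply_apply, hermiteBasis_apply, inner_hermiteLp] using
    hermiteBasis.hasSum_repr (hg.toLp g)

theorem summable_hermiteCoeff_sq {g : ℝ → ℝ} (hg : MemLp g 2 (gaussianReal 0 1)) :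
    Summable fun m => hermiteCoeff m g ^ 2 := by
  have := hermiteBasis.summable_inner_mul_inner (hg.toLp g) (hg.toLp g)
  simpa [real_inner_comm (hermiteLp _), hermiteBasis_apply, inner_hermiteLp, ← pow_two] using this

theorem summable_covTerm {g : ℝ → ℝ} (hg : MemLp g 2 (gaussianReal 0 1)) {ρ : ℝ}
    (hρ : ρ ∈ Set.Icc (-1 : ℝ) 1) : Summable (covTerm g ρ) := by
  refine (summable_hermiteCoeff_sq hg).of_norm_bounded fun m => ?_
  rw [covTerm, norm_mul, norm_pow, norm_pow, Real.norm_eq_abs, Real.norm_eq_abs, sq_abs]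
  exact mul_le_of_le_one_right (sq_nonneg _) (pow_le_one₀ (abs_nonneg _) (abs_le.2 hρ))

/-! ### Mehler's expansion for a Gaussian pair. -/

section Pair

variable {Ω : Type*} [MeasurableSpace Ω] {μ : Measure Ω} {U V : Ω → ℝ}

theorem integral_normHermite_mul_normHermite_of_hasGaussianLaw
    (hU : HasLaw U (gaussianReal 0 1) μ) (hV : HasLaw V (gaussianReal 0 1) μ)
    (hUV : HasGaussianLaw (fun ω => (U ω, V ω)) μ) (m k : ℕ) :
    ∫ ω, normHermite m (U ω) * normHermite k (V ω) ∂μ =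
      if m = k then cov[U, V; μ] ^ m else 0 := by
  have := hUV.isProbabilityMeasure
  set ρ := cov[U, V; μ] with hρ
  have hpair : HasGaussianLaw (fun ω => (U ω, V ω - ρ * U ω)) μ :=
    hUV.map_fun ((ContinuousLinearMap.fst ℝ ℝ ℝ).prod
      (ContinuousLinearMap.snd ℝ ℝ ℝ - ρ • ContinuousLinearMap.fst ℝ ℝ ℝ))
  have hU2 : MemLp U 2 μ := by simpa using memLp_of_hasLaw_gaussianReal hU 2
  have hV2 : MemLp V 2 μ := by simpa using memLp_of_hasLaw_gaussianReal hV 2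
  -- As `Var U = 1`, this is `ρ - ρ`; joint Gaussianity turns it into independence.
  have hcov : cov[U, fun ω => V ω - ρ * U ω; μ] = 0 := by
    rw [covariance_fun_sub_right hU2 hV2 (hU2.const_mul ρ), covariance_const_mul_right,
      covariance_self hU2.aemeasurable, hU.variance_eq, variance_id_gaussianReal, ← hρ]
    simp
  have h := integral_normHermite_mul_normHermite (ρ := ρ) (R := fun ω => V ω - ρ * U ω) hU
    (by simpa using hV) (hpair.indepFun_of_covariance_eq_zero hcov) m k
  simpa using h

theorem inner_compMeasurePreserving_toLp (hU : MeasurePreserving U μ (gaussianReal 0 1))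
    (hV : MeasurePreserving V μ (gaussianReal 0 1)) {f g : ℝ → ℝ}
    (hf : MemLp f 2 (gaussianReal 0 1)) (hg : MemLp g 2 (gaussianReal 0 1)) :
    inner ℝ (Lp.compMeasurePreservingₗᵢ ℝ U hU (hf.toLp f))
      (Lp.compMeasurePreservingₗᵢ ℝ V hV (hg.toLp g)) = ∫ ω, f (U ω) * g (V ω) ∂μ := by
  change inner ℝ (Lp.compMeasurePreserving U hU (hf.toLp f))
    (Lp.compMeasurePreserving V hV (hg.toLp g)) = _
  rw [Lp.toLp_compMeasurePreserving, Lp.toLp_compMeasurePreserving, L2.inner_def]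
  refine integral_congr_ae ?_
  filter_upwards [(hf.comp_measurePreserving hU).coeFn_toLp,
    (hg.comp_measurePreserving hV).coeFn_toLp] with ω h1 h2
  rw [h1, h2]
  exact mul_comm _ _

/-- Cauchy–Schwarz for the unit vectors `h_1(U)` and `h_1(V)`, whose inner product is the
covariance. -/
theorem covariance_mem_Icc
    (hU : MeasurePreserving U μ (gaussianReal 0 1)) (hV : MeasurePreserving V μ (gaussianReal 0 1))
    (hUV : HasGaussianLaw (fun ω => (U ω, V ω)) μ) : cov[U, V; μ] ∈ Set.Icc (-1 : ℝ) 1 := by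
  have h := abs_real_inner_le_norm (Lp.compMeasurePreservingₗᵢ ℝ U hU (hermiteLp 1))
    (Lp.compMeasurePreservingₗᵢ ℝ V hV (hermiteLp 1))
  rw [LinearIsometry.norm_map, LinearIsometry.norm_map, orthonormal_hermiteLp.1, one_mul,
    hermiteLp, inner_compMeasurePreserving_toLp,
    integral_normHermite_mul_normHermite_of_hasGaussianLaw hU.hasLaw hV.hasLaw hUV] at h
  exact abs_le.1 (by simpa using h)

/-- Mehler's expansion of `E[g(U) g(V)]`. -/
theorem hasSum_covTerm
    (hU : MeasurePreserving U μ (gaussianReal 0 1)) (hV : MeasurePreserving V μ (gaussianReal 0 1))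
    (hUV : HasGaussianLaw (fun ω => (U ω, V ω)) μ)
    {g : ℝ → ℝ} (hg : MemLp g 2 (gaussianReal 0 1)) :
    HasSum (covTerm g cov[U, V; μ]) (∫ ω, g (U ω) * g (V ω) ∂μ) := by
  -- Composition with `U` or `V` embeds the Gaussian `L²` isometrically into `L²(μ)`, so the Hermite
  -- expansion may be pushed through.
  set ιU := Lp.compMeasurePreservingₗᵢ (E := ℝ) (p := 2) ℝ U hU with hιU
  set ιV := Lp.compMeasurePreservingₗᵢ (E := ℝ) (p := 2) ℝ V hV with hιV
  have hherm : ∀ m k, inner ℝ (ιU (hermiteLp m)) (ιV (hermiteLp k)) =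
      if m = k then cov[U, V; μ] ^ m else 0 := fun m k => by
    rw [hιU, hιV, hermiteLp, hermiteLp, inner_compMeasurePreserving_toLp,
      integral_normHermite_mul_normHermite_of_hasGaussianLaw hU.hasLaw hV.hasLaw hUV]
  have hinner : ∀ m, inner ℝ (ιU (hermiteLp m)) (ιV (hg.toLp g)) =
      hermiteCoeff m g * cov[U, V; μ] ^ m := fun m => by
    have h1 := ((hasSum_hermiteCoeff_smul hg).mapL ιV.toContinuousLinearMap).mapL
      (innerSL ℝ (ιU (hermiteLp m)))
    have h2 := h1.unique (hasSum_single m fun k hk => by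
      simp [hherm, hk.symm])
    simpa [real_inner_smul_right, hherm] using h2
  have h1 := ((hasSum_hermiteCoeff_smul hg).mapL ιU.toContinuousLinearMap).mapL
    (innerSL ℝ (ιV (hg.toLp g)))
  rw [← inner_compMeasurePreserving_toLp hU hV hg hg, real_inner_comm]
  convert! h1 using 1
  funext m
  simp only [LinearIsometry.coe_toContinuousLinearMap, map_smul, innerSL_apply_apply, smul_eq_mul]
  rw [real_inner_comm, hinner, covTerm]
  ring

theorem covariance_comp_eq_covFun
    (hU : MeasurePreserving U μ (gaussianReal 0 1)) (hV : MeasurePreserving V μ (gaussianReal 0 1))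
    (hUV : HasGaussianLaw (fun ω => (U ω, V ω)) μ)
    {g : ℝ → ℝ} (hg : MemLp g 2 (gaussianReal 0 1)) :
    cov[fun ω => g (U ω), fun ω => g (V ω); μ] = covFun g cov[U, V; μ] := by
  have := hUV.isProbabilityMeasure
  have hmean : ∀ {W : Ω → ℝ}, MeasurePreserving W μ (gaussianReal 0 1) →
      ∫ ω, g (W ω) ∂μ = hermiteCoeff 0 g := fun hW => by
    have h := hW.hasLaw.integral_comp hg.1
    simpa [hermiteCoeff, normHermite] using! h
  have hs := hasSum_covTerm hU hV hUV hg
  have hcov : cov[fun ω => g (U ω), fun ω => g (V ω); μ] =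
      ∫ ω, g (U ω) * g (V ω) ∂μ - (∫ ω, g (U ω) ∂μ) * ∫ ω, g (V ω) ∂μ :=
    covariance_eq_sub (hg.comp_measurePreserving hU) (hg.comp_measurePreserving hV)
  rw [hcov, covFun, hmean hU, hmean hV, sub_eq_iff_eq_add, add_comm]
  -- As `h_0 = 1`, the product of the means is exactly the term `m = 0`.
  have h0 : covTerm g cov[U, V; μ] 0 = hermiteCoeff 0 g * hermiteCoeff 0 g := by
    simp [covTerm, pow_two]
  rw [← h0, ← hs.summable.tsum_eq_zero_add, hs.tsum_eq]

end Pair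

/-! ### Transfer to the coordinates of the Gaussian design. -/

section Design

variable {Ω : Type*} [MeasurableSpace Ω] {P : Measure Ω} {n : ℕ} {S : Matrix (Fin n) (Fin n) ℝ}
  {T : Ω → EuclideanSpace ℝ (Fin n)}

theorem measurePreserving_eval (hS : S ∈ elliptope n) (i : Fin n) :
    MeasurePreserving (fun x : EuclideanSpace ℝ (Fin n) => x i) (multivariateGaussian 0 S)
      (gaussianReal 0 1) := by
  simpa [hS.2 i] using measurePreserving_eval_multivariateGaussian (μ := 0) hS.1 (i := i)

theorem hasGaussianLaw_eval_prodMk (S : Matrix (Fin n) (Fin n) ℝ) (i j : Fin n) :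
    HasGaussianLaw (fun x : EuclideanSpace ℝ (Fin n) => (x i, x j)) (multivariateGaussian 0 S) :=
  IsGaussian.hasGaussianLaw_id.map_fun
    ((EuclideanSpace.proj (𝕜 := ℝ) i).prod (EuclideanSpace.proj (𝕜 := ℝ) j))

theorem apply_mem_Icc_of_mem_elliptope (hS : S ∈ elliptope n) (i j : Fin n) :
    S i j ∈ Set.Icc (-1 : ℝ) 1 := by
  have h := covariance_mem_Icc (measurePreserving_eval hS i) (measurePreserving_eval hS j)
    (hasGaussianLaw_eval_prodMk S i j)
  rwa [covariance_eval_multivariateGaussian hS.1] at h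

theorem IsGaussianDesign.memLp_applyVec (hT : IsGaussianDesign T S P) {g : ℝ → ℝ}
    (hg : MemLp g 2 (gaussianReal 0 1)) (i : Fin n) :
    MemLp (fun ω => applyVec g T ω i) 2 P := by
  have h := hg.comp_measurePreserving (measurePreserving_eval hT.mem_elliptope i)
  rw [← hT.hasLaw.map_eq] at h
  exact (memLp_map_measure_iff h.1 hT.hasLaw.aemeasurable).1 h

theorem IsGaussianDesign.covMat_applyVec (hT : IsGaussianDesign T S P) {g : ℝ → ℝ}
    (hg : MemLp g 2 (gaussianReal 0 1)) :
    covMat (applyVec g T) P = S.map (covFun g) := by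
  ext i j
  have hm : ∀ i, AEMeasurable (fun x : EuclideanSpace ℝ (Fin n) => g (x i))
      (multivariateGaussian 0 S) := fun i =>
    (hg.comp_measurePreserving (measurePreserving_eval hT.mem_elliptope i)).1.aemeasurable
  simp only [covMat, applyVec, Matrix.of_apply, Matrix.map_apply]
  rw [hT.hasLaw.covariance_fun_comp (hm i) (hm j), covariance_comp_eq_covFun
    (measurePreserving_eval hT.mem_elliptope i) (measurePreserving_eval hT.mem_elliptope j)
    (hasGaussianLaw_eval_prodMk S i j) hg,
    covariance_eval_multivariateGaussian hT.mem_elliptope.1]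

end Design

end GaussianDesign


theorem proposition2 {Ω : Type*} [MeasurableSpace Ω] (P : Measure Ω) (n : ℕ)
    (S : Matrix (Fin n) (Fin n) ℝ) (T : Ω → EuclideanSpace ℝ (Fin n))
    (hT : GaussianDesign.IsGaussianDesign T S P)
    (Y₀ w : ℝ → ℝ)
    (hYw : MemLp (fun t => Y₀ t * w t) 2 (gaussianReal 0 1))
    (hw : MemLp w 2 (gaussianReal 0 1)) :
    -- the covariance matrices are those of square-integrable random vectors
    (∀ i, MemLp (fun ω => (GaussianDesign.applyVec Y₀ T * GaussianDesign.applyVec w T) ω i) 2 P) ∧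
    (∀ i, MemLp (fun ω => GaussianDesign.applyVec w T ω i) 2 P) ∧
    -- the series converge on `[-1, 1]`, which contains the entries of `S`
    (∀ ρ ∈ Set.Icc (-1 : ℝ) 1,
      Summable (fun m : ℕ => GaussianDesign.covTerm (fun t => Y₀ t * w t) ρ (m + 1)) ∧
      Summable (fun m : ℕ => GaussianDesign.covTerm w ρ (m + 1))) ∧
    (∀ i j, S i j ∈ Set.Icc (-1 : ℝ) 1) ∧
    -- the two covariance formulas
    GaussianDesign.covMat (GaussianDesign.applyVec Y₀ T * GaussianDesign.applyVec w T) P =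
      S.map (GaussianDesign.covFun (fun t => Y₀ t * w t)) ∧
    GaussianDesign.covMat (GaussianDesign.applyVec w T) P =
      S.map (GaussianDesign.covFun w) := by

  have hmul : GaussianDesign.applyVec Y₀ T * GaussianDesign.applyVec w T =
      GaussianDesign.applyVec (fun t => Y₀ t * w t) T := rfl
  rw [hmul]
  exact ⟨hT.memLp_applyVec hYw, hT.memLp_applyVec hw,
    fun ρ hρ => ⟨(summable_nat_add_iff 1).2 (GaussianDesign.summable_covTerm hYw hρ),
      (summable_nat_add_iff 1).2 (GaussianDesign.summable_covTerm hw hρ)⟩,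
    GaussianDesign.apply_mem_Icc_of_mem_elliptope hT.mem_elliptope,
    hT.covMat_applyVec hYw, hT.covMat_applyVec hw⟩
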